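/- **Theorem.** Coloring Reconfiguration under Color Swapping (CRCS), with the number $k$ of colors part of the input, can be solved in polynomial time on cographs. *Definitions.* A proper $k$-coloring of a finite graph $G=(V,E)$ is a map $f\colon V\to\{1,\dots,k\}$ with $f(u)\neq f(v)$ for every edge $uv\in E$. Two proper $k$-colorings $f,f'$ of $G$ are *adjacent under color swapping* if there is exactly one edge $uv\in E$ with $f(u)=f'(v)$ and $f(v)=f'(u)$, and $f(w)=f'(w)$ for all $w\in V\setminus\{u,v\}$. They are *reconfigurable* if there is a finite sequence $f=f_0,f_1,\dots,f_\ell=f'$ ($\ell\ge 0$) of proper $k$-colorings of $G$ in which consecutive colorings are adjacent under color swapping. An instance of CRCS is a tuple $(G,k,f_s,f_t)$ of a finite graph $G$, an integer $k\geq 1$ and two proper $k$-colorings $f_s,f_t$ of $G$; the question is whether $f_s$ and $f_t$ are reconfigurable. *Cographs* are the graphs obtained from single-vertex graphs by repeatedly taking disjoint unions and joins (the join of two vertex-disjoint graphs is their union together with all edges between them). *Claim.* There are one deterministic algorithm and one polynomial $p$ such that for every instance $(G,k,f_s,f_t)$ of CRCS in which $G$ is a cograph, the algorithm, given $|V|$,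 $k$, the adjacency matrix of $G$ and the two lists of colors, halts after at most $p(N)$ steps and answers correctly whether $f_s$ and $f_t$ are reconfigurable. Here $N$ is the length of the input with numbers written in binary, and steps are those of a random access machine whose elementary operations (copying, addition, truncated subtraction, comparison, indirect memory access; no multiplication) cost one step each, a model polynomially equivalent to Turing machines. -/

import Mathlib

/-! ### Color swapping and cographs -/

namespace CRCS

/-- Two proper `k`-colorings `f`, `f'` of `G` are adjacent under color swapping: there is exactly
one edge `uv` with `f u = f' v` and `f v = f' u`, and `f`, `f'` agree at all other vertices. -/
def SwapAdj {V : Type*} (G : SimpleGraph V) {k : ℕ} (f f' : G.Coloring (Fin k)) : Prop :=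
  ∃ u v : V, G.Adj u v ∧ f u = f' v ∧ f v = f' u ∧
    (∀ x y : V, G.Adj x y → f x = f' y → f y = f' x → s(x, y) = s(u, v)) ∧
    ∀ w : V, w ≠ u → w ≠ v → f w = f' w

/-- `f` and `f'` are reconfigurable: there is a finite sequence `f = f₀, f₁, …, f_ℓ = f'` of
proper `k`-colorings (`ℓ = 0` allowed) in which consecutive colorings are adjacent under color
swapping. -/
def Reconfigurable {V : Type*} (G : SimpleGraph V) {k : ℕ} (f f' : G.Coloring (Fin k)) : Prop :=
  Relation.ReflTransGen (SwapAdj G) f f'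

/-- `IsCographOn G S`: the subgraph of `G` induced by `S` is a cograph, that is, it is built from
single vertices by disjoint unions and joins. -/
inductive IsCographOn {V : Type*} (G : SimpleGraph V) : Set V → Prop
  | single (v : V) : IsCographOn G {v}
  | union (A B : Set V) : IsCographOn G A → IsCographOn G B → Disjoint A B →
      (∀ a ∈ A, ∀ b ∈ B, ¬ G.Adj a b) → IsCographOn G (A ∪ B)
  | join (A B : Set V) : IsCographOn G A → IsCographOn G B → Disjoint A B →
      (∀ a ∈ A, ∀ b ∈ B, G.Adj a b) → IsCographOn G (A ∪ B)

/-- `G` is a cograph. -/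
def IsCograph {V : Type*} (G : SimpleGraph V) : Prop := IsCographOn G Set.univ

/-- An instance `(G, k, f_s, f_t)` of Coloring Reconfiguration under Color Swapping. The vertices
are `0, …, n - 1`; the number `k` of colors is part of the input. -/
structure Instance where
  /-- number of vertices -/
  n : ℕ
  /-- the graph -/
  G : SimpleGraph (Fin n)
  /-- number of colors -/
  k : ℕ
  k_pos : 0 < k
  /-- initial proper coloring -/
  fs : G.Coloring (Fin k)
  /-- target proper coloring -/
  ft : G.Coloring (Fin k)

/-- The yes-instances. -/
def Instance.IsYes (I : Instance) : Prop := Reconfigurable I.G I.fs I.ft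

open Classical in
/-- The encoding of an instance as a list of numbers: `n`, `k`, the adjacency matrix of `G` row by
row, the list of colors of `f_s`, the list of colors of `f_t`. -/
noncomputable def Instance.encode (I : Instance) : List ℕ :=
  [I.n, I.k] ++
    List.ofFn (fun i : Fin (I.n * I.n) => if I.G.Adj i.divNat i.modNat then 1 else 0) ++
    List.ofFn (fun v : Fin I.n => (I.fs v : ℕ)) ++
    List.ofFn (fun v : Fin I.n => (I.ft v : ℕ))

end CRCS

/-! ### Polynomial time

The machine model is a random access machine, programmed with structured control flow. It has
variables and arrays of natural numbers, of which a program can name finitely many. Every elementary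
operation costs one step. The only arithmetic is addition, truncated subtraction and comparison
(no multiplication), so that a run of `t` steps lengthens the numbers in memory by at most `t` bits
and unit cost agrees with Turing machine time up to a polynomial. -/

namespace RAM

/-- The contents of the memory. -/
structure State where
  /-- the value of each variable -/
  var : ℕ → ℕ
  /-- the value of each array at each index -/
  arr : ℕ → ℕ → ℕ

/-- Assign the value `m` to the variable `x`. -/
def State.setVar (s : State) (x m : ℕ) : State :=
  { s with var := Function.update s.var x m }

/-- Store the value `m` in the array `a` at index `i`. -/
def State.setArr (s : State) (a i m : ℕ) : State :=
  { s with arr := Function.update s.arr a (Function.update (s.arr a) i m) }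

/-- Expressions; `get a i` reads the array `a` at index `i`, and a comparison has value 1 if it
holds and 0 if not. -/
inductive Expr
  | const (m : ℕ)
  | var (x : ℕ)
  | get (a : ℕ) (i : Expr)
  | add (e₁ e₂ : Expr)
  | sub (e₁ e₂ : Expr)
  | lt (e₁ e₂ : Expr)
  | eq (e₁ e₂ : Expr)

/-- The value of an expression. -/
def Expr.eval (s : State) : Expr → ℕ
  | .const m => m
  | .var x => s.var x
  | .get a i => s.arr a (i.eval s)
  | .add e₁ e₂ => e₁.eval s + e₂.eval s
  | .sub e₁ e₂ => e₁.eval s - e₂.eval s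
  | .lt e₁ e₂ => if e₁.eval s < e₂.eval s then 1 else 0
  | .eq e₁ e₂ => if e₁.eval s = e₂.eval s then 1 else 0

/-- The number of elementary operations in the evaluation of an expression. -/
def Expr.cost : Expr → ℕ
  | .const _ => 1
  | .var _ => 1
  | .get _ i => i.cost + 1
  | .add e₁ e₂ => e₁.cost + e₂.cost + 1
  | .sub e₁ e₂ => e₁.cost + e₂.cost + 1
  | .lt e₁ e₂ => e₁.cost + e₂.cost + 1
  | .eq e₁ e₂ => e₁.cost + e₂.cost + 1

/-- Programs: no operation, assignment to a variable, assignment to an array entry, sequential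
composition, case distinction (is the value of `e` nonzero?), and `while e ≠ 0 do p`. -/
inductive Prog
  | noop
  | assign (x : ℕ) (e : Expr)
  | store (a : ℕ) (i e : Expr)
  | seq (p q : Prog)
  | cond (e : Expr) (p q : Prog)
  | loop (e : Expr) (p : Prog)

/-- `Exec p s t s'`: the program `p`, started in `s`, halts after exactly `t` steps in `s'`. -/
inductive Exec : Prog → State → ℕ → State → Prop
  | noop (s : State) : Exec .noop s 1 s
  | assign (s : State) (x : ℕ) (e : Expr) :
      Exec (.assign x e) s (e.cost + 1) (s.setVar x (e.eval s))
  | store (s : State) (a : ℕ) (i e : Expr) :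
      Exec (.store a i e) s (i.cost + e.cost + 1) (s.setArr a (i.eval s) (e.eval s))
  | seq {s s' s'' : State} {p q : Prog} {t t' : ℕ} :
      Exec p s t s' → Exec q s' t' s'' → Exec (.seq p q) s (t + t') s''
  | cond_true {s s' : State} {e : Expr} {p q : Prog} {t : ℕ} :
      e.eval s ≠ 0 → Exec p s t s' → Exec (.cond e p q) s (e.cost + 1 + t) s'
  | cond_false {s s' : State} {e : Expr} {p q : Prog} {t : ℕ} :
      e.eval s = 0 → Exec q s t s' → Exec (.cond e p q) s (e.cost + 1 + t) s'
  | loop_true {s s' s'' : State} {e : Expr} {p : Prog} {t t' : ℕ} :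
      e.eval s ≠ 0 → Exec p s t s' → Exec (.loop e p) s' t' s'' →
      Exec (.loop e p) s (e.cost + 1 + t + t') s''
  | loop_false {s : State} {e : Expr} {p : Prog} :
      e.eval s = 0 → Exec (.loop e p) s (e.cost + 1) s

/-- The initial memory on the input `L`: array 0 holds the entries of `L`, variable 0 holds the
length of `L`, and everything else is 0. -/
def State.init (L : List ℕ) : State where
  var := fun x => if x = 0 then L.length else 0
  arr := fun a i => if a = 0 then L.getD i 0 else 0

/-- The size of an input: the total number of binary digits, plus one separator per entry. -/
def inputSize (L : List ℕ) : ℕ := (L.map fun m => m.size + 1).sum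

/-- The decision problem `Yes` on the instances in `Dom`, encoded by `enc`, is solvable in
polynomial time: one program halts on every instance in `Dom` within a number of steps that is
polynomial in the input size, with 1 in variable 0 on yes-instances and 0 on no-instances. -/
def SolvableInPolyTime {α : Type*} (enc : α → List ℕ) (Dom Yes : α → Prop) : Prop :=
  ∃ (p : Prog) (b : Polynomial ℕ), ∀ I : α, Dom I →
    ∃ (t : ℕ) (s : State), Exec p (State.init (enc I)) t s ∧
      t ≤ b.eval (inputSize (enc I)) ∧
      (Yes I → s.var 0 = 1) ∧ (¬ Yes I → s.var 0 = 0)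

end RAM

/-!
An edge `xy` of a cograph determines a node of the cotree, the lowest common ancestor of `x` and
`y`; let its core be the set of leaves below this node. If the coloring is proper, the colors of `x`
and `y` can be swapped exactly if each of them occurs only once in the core, and then they can be
moved anywhere in the core without disturbing the other vertices except by exchanging two colors.
Cores are pairwise nested or disjoint, and which vertices a color can reach is not affected by such
swaps. Hence `f` can be reconfigured to `f'` exactly if every color of `f` can be moved, on its own,
to a vertex where `f'` has that color: as long as `f ≠ f'`, a smallest core in which a misplaced
color can be moved to its destination contains two colors whose exchange decreases the number of
misplaced colors.

Since the core of `xy` is first-order definable, so is this condition, in the structure formed by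
adjacency and equality of colors, and a fixed first-order sentence is checked in polynomial time by
nested loops.
-/

/-! ### Swappable edges of cographs -/

namespace CRCS

section Core

variable {V : Type*} {G : SimpleGraph V}

/-- Every walk `a b c d` of length three closes up to a 4-cycle or a triangle, that is, no four
vertices induce a path. Coinciding vertices satisfy the condition automatically. -/
def P4Free (G : SimpleGraph V) : Prop :=
  ∀ ⦃a b c d : V⦄, G.Adj a b → G.Adj b c → G.Adj c d → G.Adj a c ∨ G.Adj b d ∨ G.Adj a d

theorem IsCographOn.p4Free_induce {S : Set V} (h : IsCographOn G S) : P4Free (G.induce S) := by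
  rintro ⟨a, ha⟩ ⟨b, hb⟩ ⟨c, hc⟩ ⟨d, hd⟩
  simp only [SimpleGraph.comap_adj, Function.Embedding.subtype_apply]
  induction h generalizing a b c d with
  | single v => grind [SimpleGraph.irrefl]
  | union A B _ _ _ hAB ihA ihB =>
    intro hab hbc hcd
    have same_side {u v} (hu : u ∈ A ∪ B) (hv : v ∈ A ∪ B) (huv : G.Adj u v) :
        u ∈ A ↔ v ∈ A := by
      grind [G.adj_comm]
    by_cases haA : a ∈ A <;> grind
  | join A B _ _ _ hAB ihA ihB => grind [G.adj_comm]

theorem IsCograph.p4Free (h : IsCograph G) : P4Free G := fun a b c d =>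
  @IsCographOn.p4Free_induce V G _ h ⟨a, trivial⟩ ⟨b, trivial⟩ ⟨c, trivial⟩ ⟨d, trivial⟩

/-- For an edge `xy` of a cograph, the set of leaves below the lowest common ancestor of `x` and
`y` in the cotree: the vertices whose closed neighborhood lies in `N(x) ∪ N(y)`. -/
def core (G : SimpleGraph V) (x y : V) : Set V :=
  {w | (G.Adj w x ∨ G.Adj w y) ∧ ∀ z, G.Adj z w → G.Adj z x ∨ G.Adj z y}

theorem core_comm (x y : V) : core G x y = core G y x := by
  simp only [core, or_comm]

theorem left_mem_core {x y : V} (h : G.Adj x y) : x ∈ core G x y :=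
  ⟨.inr h, fun _ => .inl⟩

theorem right_mem_core {x y : V} (h : G.Adj x y) : y ∈ core G x y :=
  ⟨.inl h.symm, fun _ => .inr⟩

theorem core_subset_core {a b x y : V}
    (h : ∀ z, G.Adj z a ∨ G.Adj z b → G.Adj z x ∨ G.Adj z y) : core G a b ⊆ core G x y :=
  fun w hw => ⟨h w hw.1, fun z hz => h z (hw.2 z hz)⟩

theorem core_subset_of_mem {a b x y : V} (ha : a ∈ core G x y) (hb : b ∈ core G x y) :
    core G a b ⊆ core G x y :=
  core_subset_core fun z hz => hz.elim (ha.2 z) (hb.2 z)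

theorem exists_common_neighbor_of_not_adj (hG : P4Free G) {x y v w : V} (hxy : G.Adj x y)
    (hv : v ∈ core G x y) (hw : w ∈ core G x y) (hvw : ¬ G.Adj v w) :
    (G.Adj v x ∧ G.Adj w x) ∨ (G.Adj v y ∧ G.Adj w y) := by
  grind [P4Free, core, G.adj_comm]

/-- In the language of modular decomposition, `core G x y` is a module. -/
theorem adj_of_adj_core (hG : P4Free G) {x y z w v : V} (hxy : G.Adj x y)
    (hz : z ∉ core G x y) (hw : w ∈ core G x y) (hzw : G.Adj z w) (hv : v ∈ core G x y) :
    G.Adj z v := by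
  obtain ⟨q, hqz, hqx, hqy⟩ : ∃ q, G.Adj q z ∧ ¬ G.Adj q x ∧ ¬ G.Adj q y := by
    by_contra! h
    exact hz ⟨hw.2 z hzw, fun q hq => or_iff_not_imp_left.2 (h q hq)⟩
  have hqv : ¬ G.Adj q v := fun h => (hv.2 q h).elim hqx hqy
  have hzxy : G.Adj z x ∧ G.Adj z y := by
    rcases hw.2 z hzw with hzx | hzy
    · exact ⟨hzx, by simpa [hqx, hqy] using hG hqz hzx hxy⟩
    · exact ⟨by simpa [hqx, hqy] using hG hqz hzy hxy.symm, hzy⟩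
  rcases hv.1 with hvx | hvy
  · simpa [hqx, hqv] using hG hqz hzxy.1 hvx.symm
  · simpa [hqy, hqv] using hG hqz hzxy.2 hvy.symm

section Overlap

variable {x y a b w q : V}

theorem mem_core_of_overlap (hG : P4Free G) (hab : G.Adj a b) (hw : w ∈ core G x y)
    (hw' : w ∈ core G a b) (hq : G.Adj q a ∨ G.Adj q b) (hq' : ¬ (G.Adj q x ∨ G.Adj q y)) :
    q ∈ core G a b := by
  by_contra hqab
  have hqw : G.Adj q w := hq.elim
    (fun h => adj_of_adj_core hG hab hqab (left_mem_core hab) h hw')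
    (fun h => adj_of_adj_core hG hab hqab (right_mem_core hab) h hw')
  exact hq' (hw.2 q hqw)

theorem core_nested (hG : P4Free G) (hxy : G.Adj x y) (hab : G.Adj a b)
    (hw : w ∈ core G x y) (hw' : w ∈ core G a b) :
    core G x y ⊆ core G a b ∨ core G a b ⊆ core G x y := by
  by_contra! h
  obtain ⟨p, hp, hp'⟩ : ∃ p, (G.Adj p x ∨ G.Adj p y) ∧ ¬ (G.Adj p a ∨ G.Adj p b) := by
    by_contra! h'
    exact h.1 (core_subset_core h')
  obtain ⟨q, hq, hq'⟩ : ∃ q, (G.Adj q a ∨ G.Adj q b) ∧ ¬ (G.Adj q x ∨ G.Adj q y) := by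
    by_contra! h'
    exact h.2 (core_subset_core h')
  have hqab : q ∈ core G a b := mem_core_of_overlap hG hab hw hw' hq hq'
  have mem_of_adj {u v : V} (hu : u ∈ core G x y) (hv : v ∈ core G a b) (huv : G.Adj u v) :
      u ∈ core G a b := by
    by_contra hu'
    exact hq' (hu.2 q (adj_of_adj_core hG hab hu' hv huv hqab).symm)
  have hx := left_mem_core hxy
  have hy := right_mem_core hxy
  obtain ⟨hxab, hyab⟩ : x ∈ core G a b ∧ y ∈ core G a b := by
    rcases hw.1 with hwx | hwy
    · have hxab := mem_of_adj hx hw' hwx.symm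
      exact ⟨hxab, mem_of_adj hy hxab hxy.symm⟩
    · have hyab := mem_of_adj hy hw' hwy.symm
      exact ⟨mem_of_adj hx hyab hxy, hyab⟩
  exact hp' (hp.elim (hxab.2 p) (hyab.2 p))

end Overlap

theorem core_subset_of_notMem (hG : P4Free G) {x y a b : V} (hxy : G.Adj x y) (hab : G.Adj a b)
    (ha : a ∈ core G x y) (hb : b ∉ core G x y) : core G x y ⊆ core G a b :=
  (core_nested hG hxy hab ha (left_mem_core hab)).resolve_right fun h => hb (h (right_mem_core hab))

theorem core_eq_or_core_eq (hG : P4Free G) {x y b : V} (hxy : G.Adj x y) (hb : b ∈ core G x y)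
    (hbx : G.Adj b x) :
    core G b x = core G x y ∨ G.Adj b y ∧ core G b y = core G x y := by
  by_cases hz : ∃ z, G.Adj z y ∧ ¬ G.Adj z x ∧ ¬ G.Adj z b
  · obtain ⟨z, hzy, hzx, hzb⟩ := hz
    have hby : G.Adj b y := by
      simpa [hzx, hzb, G.adj_comm] using hG hzy hxy.symm hbx.symm
    refine .inr ⟨hby, (core_subset_of_mem hb (right_mem_core hxy)).antisymm
      (core_subset_core fun u hu => ?_)⟩
    grind [P4Free, G.adj_comm]
  · push Not at hz
    exact .inl ((core_subset_of_mem hb (left_mem_core hxy)).antisymm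
      (core_subset_core fun u hu => by grind))

end Core

section Activity

variable {V α : Type*} {G : SimpleGraph V} {f f' : V → α} {S T : Set V} {a b v w x y : V}

/-- No other vertex of `S` has the color of `v`; the vertex `v` itself need not lie in `S`. -/
def UniqueIn (f : V → α) (S : Set V) (v : V) : Prop :=
  ∀ u ∈ S, f u = f v → u = v

theorem UniqueIn.mono (h : UniqueIn f T v) (hST : S ⊆ T) : UniqueIn f S v :=
  fun u hu => h u (hST hu)

/-- An active edge: the colors of its ends occur only once in its core. For a proper coloring of a
cograph, these are the edges whose ends can be swapped. -/
def Active (G : SimpleGraph V) (f : V → α) (x y : V) : Prop :=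
  G.Adj x y ∧ UniqueIn f (core G x y) x ∧ UniqueIn f (core G x y) y

theorem Active.symm (h : Active G f x y) : Active G f y x :=
  ⟨h.1.symm, core_comm (G := G) x y ▸ h.2.symm⟩

theorem uniqueIn_core_left_iff (hG : P4Free G) (hf : ∀ ⦃u v⦄, G.Adj u v → f u ≠ f v)
    (hxy : G.Adj x y) :
    UniqueIn f (core G x y) x ↔ ∀ u, G.Adj u y → f u = f x → u = x := by
  refine ⟨fun h u huy hux => h u ⟨.inr huy, fun q hqu => ?_⟩ hux,
    fun h u hu hux => h u (hu.1.resolve_left fun hadj => hf hadj hux) hux⟩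
  have hux' : ¬ G.Adj u x := fun hadj => hf hadj hux
  simpa [hux', or_comm] using hG hqu huy hxy.symm

theorem active_iff_of_proper (hG : P4Free G) (hf : ∀ ⦃u v⦄, G.Adj u v → f u ≠ f v) :
    Active G f x y ↔
      G.Adj x y ∧ (∀ u, G.Adj u y → f u = f x → u = x) ∧ ∀ u, G.Adj u x → f u = f y → u = y :=
  and_congr_right fun hxy => and_congr (uniqueIn_core_left_iff hG hf hxy)
    (core_comm (G := G) x y ▸ uniqueIn_core_left_iff hG hf hxy.symm)

/-- The core of an active edge. -/
def IsActiveCore (G : SimpleGraph V) (f : V → α) (S : Set V) : Prop :=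
  ∃ x y, Active G f x y ∧ core G x y = S

theorem IsActiveCore.nested (hG : P4Free G) (hS : IsActiveCore G f S) (hT : IsActiveCore G f T)
    (hvS : v ∈ S) (hvT : v ∈ T) : S ⊆ T ∨ T ⊆ S := by
  obtain ⟨x, y, hxy, rfl⟩ := hS
  obtain ⟨a, b, hab, rfl⟩ := hT
  exact core_nested hG hxy.1 hab.1 hvS hvT

/-- The color of `v` can be moved anywhere in `S`: it occurs only once in `S`, the core of an
active edge. -/
def Movable (G : SimpleGraph V) (f : V → α) (S : Set V) (v : V) : Prop :=
  IsActiveCore G f S ∧ v ∈ S ∧ UniqueIn f S v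

theorem Active.movable_left (h : Active G f x y) : Movable G f (core G x y) x :=
  ⟨⟨x, y, h, rfl⟩, left_mem_core h.1, h.2.1⟩

theorem Active.movable_right (h : Active G f x y) : Movable G f (core G x y) y :=
  ⟨⟨x, y, h, rfl⟩, right_mem_core h.1, h.2.2⟩

/-- The color at `v` can be moved to `w`. -/
def Reaches (G : SimpleGraph V) (f : V → α) (v w : V) : Prop :=
  w = v ∨ ∃ S, Movable G f S v ∧ w ∈ S

/-- Every color of `f` can be moved, on its own, to a vertex where `f'` has that color. -/
def Compatible (G : SimpleGraph V) (f f' : V → α) : Prop :=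
  ∀ v, ∃ w, Reaches G f v w ∧ f' w = f v

theorem Compatible.refl (f : V → α) : Compatible G f f :=
  fun v => ⟨v, .inl rfl, rfl⟩

theorem Compatible.exists_movable (h : Compatible G f f') (hv : f v ≠ f' v) :
    ∃ S w, Movable G f S v ∧ w ∈ S ∧ f w ≠ f' w ∧ f' w = f v := by
  obtain ⟨w, rfl | ⟨S, hvS, hwS⟩, hw⟩ := h v
  · exact absurd hw.symm hv
  refine ⟨S, w, hvS, hwS, fun hww => hv ?_, hw⟩
  rwa [← hvS.2.2 w hwS (hww.trans hw)]

/-- Take the smallest core in which some misplaced color can be moved to its destination. -/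
theorem Compatible.exists_exchange (hG : P4Free G) [Finite V] (h : Compatible G f f')
    (hne : f ≠ f') :
    ∃ S v w, Movable G f S v ∧ Movable G f S w ∧ f v ≠ f' v ∧ f w ≠ f' w ∧ f' w = f v := by
  let Exchange (S : Set V) : Prop :=
    ∃ v w, Movable G f S v ∧ w ∈ S ∧ f v ≠ f' v ∧ f w ≠ f' w ∧ f' w = f v
  have exists_exchange {v : V} (hv : f v ≠ f' v) :
      ∃ S, Movable G f S v ∧ Exchange S := by
    obtain ⟨S, w, hvS, hwS, hw, hwv⟩ := h.exists_movable hv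
    exact ⟨S, hvS, v, w, hvS, hwS, hv, hw, hwv⟩
  obtain ⟨v₀, hv₀⟩ := Function.ne_iff.1 hne
  obtain ⟨S₀, -, hS₀⟩ := exists_exchange hv₀
  obtain ⟨S, ⟨v, w, hvS, hwS, hv, hw, hwv⟩, hmin⟩ :=
    exists_minimal_of_wellFoundedLT Exchange ⟨S₀, hS₀⟩
  obtain ⟨T, hwT, hT⟩ := exists_exchange hw
  have hST : S ⊆ T := (hvS.1.nested hG hwT.1 hwS hwT.2.1).elim id (hmin hT)
  exact ⟨S, v, w, hvS, ⟨hvS.1, hwS, hwT.2.2.mono hST⟩, hv, hw, hwv⟩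

variable [DecidableEq V]

theorem swap_mem_iff (hab : a ∈ S ↔ b ∈ S) : Equiv.swap a b v ∈ S ↔ v ∈ S := by
  grind

theorem uniqueIn_comp_swap (hab : a ∈ S ↔ b ∈ S) :
    UniqueIn (f ∘ Equiv.swap a b) S v ↔ UniqueIn f S (Equiv.swap a b v) := by
  refine (Equiv.swap a b).forall_congr fun u => ?_
  simp only [swap_mem_iff hab, Function.comp_apply, (Equiv.swap a b).injective.eq_iff]

theorem IsActiveCore.of_comp_swap_left (hG : P4Free G) (hxb : Active G f x b)
    (hxy : Active G (f ∘ Equiv.swap x b) x y) (hb : b ∈ core G x y) :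
    IsActiveCore G f (core G x y) := by
  have hxb_mem : x ∈ core G x y ↔ b ∈ core G x y := iff_of_true (left_mem_core hxy.1) hb
  rcases core_eq_or_core_eq hG hxy.1 hb hxb.1.symm with hcore | ⟨hby, hcore⟩
  · exact ⟨b, x, hxb.symm, hcore⟩
  · have hb_unique := (uniqueIn_comp_swap hxb_mem).1 hxy.2.1
    have hy_unique := (uniqueIn_comp_swap hxb_mem).1 hxy.2.2
    rw [Equiv.swap_apply_left] at hb_unique
    rw [Equiv.swap_apply_of_ne_of_ne hxy.1.ne' hby.ne'] at hy_unique
    exact ⟨b, y, ⟨hby, hcore ▸ hb_unique, hcore ▸ hy_unique⟩, hcore⟩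

theorem IsActiveCore.of_comp_swap (hG : P4Free G) (hab : Active G f a b)
    (hS : IsActiveCore G (f ∘ Equiv.swap a b) S) (habS : a ∈ S ↔ b ∈ S) : IsActiveCore G f S := by
  obtain ⟨x, y, hxy, rfl⟩ := hS
  have hx := left_mem_core hxy.1
  have hy := right_mem_core hxy.1
  by_cases hxa : x = a
  · subst hxa
    exact of_comp_swap_left hG hab hxy (habS.1 hx)
  by_cases hxb : x = b
  · subst hxb
    exact of_comp_swap_left hG hab.symm (Equiv.swap_comm a x ▸ hxy) (habS.2 hx)
  by_cases hya : y = a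
  · subst hya
    rw [core_comm] at habS hy ⊢
    exact of_comp_swap_left hG hab hxy.symm (habS.1 hy)
  by_cases hyb : y = b
  · subst hyb
    rw [core_comm] at habS hy ⊢
    exact of_comp_swap_left hG hab.symm (Equiv.swap_comm a y ▸ hxy.symm) (habS.2 hy)
  refine ⟨x, y, ⟨hxy.1, ?_, ?_⟩, rfl⟩
  · simpa only [uniqueIn_comp_swap habS, Equiv.swap_apply_of_ne_of_ne hxa hxb] using hxy.2.1
  · simpa only [uniqueIn_comp_swap habS, Equiv.swap_apply_of_ne_of_ne hya hyb] using hxy.2.2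

theorem UniqueIn.of_comp_swap_of_notMem (ha : UniqueIn f S a) (hb : b ∉ S) (hv : v ∈ S)
    (h : UniqueIn (f ∘ Equiv.swap a b) S v) : UniqueIn f S v := by
  intro u hu huv
  by_cases hva : v = a
  · exact hva ▸ ha u hu (hva ▸ huv)
  by_cases hua : u = a
  · exact hua ▸ (ha v hv (hua ▸ huv.symm)).symm
  refine h u hu ?_
  simpa [Equiv.swap_apply_of_ne_of_ne hua (ne_of_mem_of_not_mem hu hb),
    Equiv.swap_apply_of_ne_of_ne hva (ne_of_mem_of_not_mem hv hb)] using huv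

/-- The edge `ab` leaves `S`, so its core contains `S`. -/
theorem Movable.reaches_of_comp_swap_of_notMem (hG : P4Free G) (hab : Active G f a b)
    (hv : Movable G (f ∘ Equiv.swap a b) S (Equiv.swap a b v)) (ha : a ∈ S) (hb : b ∉ S)
    (hw : w ∈ S) : Reaches G f v w := by
  obtain ⟨⟨x, y, hxy, rfl⟩, hvS, hv_unique⟩ := hv
  have hsub := core_subset_of_notMem hG hxy.1 hab.1 ha hb
  have uniqueIn_of_mem {u : V} := (hab.2.1.mono hsub).of_comp_swap_of_notMem (v := u) hb
  by_cases hvb : v = b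
  · exact .inr ⟨_, hvb ▸ hab.movable_right, hsub hw⟩
  have hva : v ≠ a := by
    rintro rfl
    exact hb (by simpa using hvS)
  rw [Equiv.swap_apply_of_ne_of_ne hva hvb] at hvS hv_unique
  have hxy' : Active G f x y := ⟨hxy.1, uniqueIn_of_mem (left_mem_core hxy.1) hxy.2.1,
    uniqueIn_of_mem (right_mem_core hxy.1) hxy.2.2⟩
  exact .inr ⟨_, ⟨⟨x, y, hxy', rfl⟩, hvS, uniqueIn_of_mem hvS hv_unique⟩, hw⟩

theorem Active.reaches_swap (hab : Active G f a b) : Reaches G f v (Equiv.swap a b v) := by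
  by_cases hva : v = a
  · subst hva
    exact .inr ⟨_, hab.movable_left, by simpa using right_mem_core hab.1⟩
  by_cases hvb : v = b
  · subst hvb
    exact .inr ⟨_, hab.movable_right, by simpa using left_mem_core hab.1⟩
  exact .inl (Equiv.swap_apply_of_ne_of_ne hva hvb)

theorem Reaches.of_comp_swap (hG : P4Free G) (hab : Active G f a b)
    (h : Reaches G (f ∘ Equiv.swap a b) (Equiv.swap a b v) w) : Reaches G f v w := by
  obtain rfl | ⟨S, hv, hw⟩ := h
  · exact hab.reaches_swap
  by_cases habS : a ∈ S ↔ b ∈ S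
  · refine .inr ⟨S, ⟨hv.1.of_comp_swap hG hab habS, (swap_mem_iff habS).1 hv.2.1, ?_⟩, hw⟩
    simpa only [uniqueIn_comp_swap habS, Equiv.swap_apply_self] using hv.2.2
  by_cases ha : a ∈ S
  · exact hv.reaches_of_comp_swap_of_notMem hG hab ha (by tauto) hw
  · rw [Equiv.swap_comm] at hv
    exact hv.reaches_of_comp_swap_of_notMem hG hab.symm (by tauto) ha hw

theorem Compatible.of_comp_swap (hG : P4Free G) (hab : Active G f a b)
    (h : Compatible G (f ∘ Equiv.swap a b) f') : Compatible G f f' := by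
  intro v
  obtain ⟨w, hvw, hw⟩ := h (Equiv.swap a b v)
  exact ⟨w, hvw.of_comp_swap hG hab, by simpa using hw⟩

end Activity

section SwapStep

variable {V α : Type*} [DecidableEq V] {G : SimpleGraph V} {f f' g : V → α} {S : Set V}
  {a b v w x y : V}

/-- The map `g` is obtained from `f` by swapping the colors of the ends of an active edge. The maps
need not be proper colorings. -/
def SwapStep (G : SimpleGraph V) (f g : V → α) : Prop :=
  ∃ a b, Active G f a b ∧ g = f ∘ Equiv.swap a b

theorem SwapStep.symm (h : SwapStep G f g) : SwapStep G g f := by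
  obtain ⟨a, b, hab, rfl⟩ := h
  have hmem : a ∈ core G a b ↔ b ∈ core G a b :=
    iff_of_true (left_mem_core hab.1) (right_mem_core hab.1)
  refine ⟨a, b, ⟨hab.1, ?_, ?_⟩, ?_⟩
  · simpa [uniqueIn_comp_swap hmem] using hab.2.2
  · simpa [uniqueIn_comp_swap hmem] using hab.2.1
  · ext u
    simp

instance : Std.Symm (SwapStep (α := α) G) := ⟨fun _ _ => SwapStep.symm⟩

theorem SwapStep.of_uniqueIn_core (ha : a ∈ core G x y) (hb : b ∈ core G x y) (hab : G.Adj a b)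
    (ha' : UniqueIn f (core G x y) a) (hb' : UniqueIn f (core G x y) b) :
    SwapStep G f (f ∘ Equiv.swap a b) :=
  have hsub := core_subset_of_mem ha hb
  ⟨a, b, ⟨hab, ha'.mono hsub, hb'.mono hsub⟩, rfl⟩

/-- Conjugation: `(v c)(w c)(v c) = (v w)`. -/
theorem reflTransGen_swapStep_of_common_neighbor {c : V} (hv : v ∈ core G x y)
    (hw : w ∈ core G x y) (hc : c ∈ core G x y) (hv' : UniqueIn f (core G x y) v)
    (hw' : UniqueIn f (core G x y) w) (hc' : UniqueIn f (core G x y) c) (hvw : v ≠ w)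
    (hvc : G.Adj v c) (hwc : G.Adj w c) :
    Relation.ReflTransGen (SwapStep G) f (f ∘ Equiv.swap v w) := by
  have hconj : f ∘ Equiv.swap v w =
      ((f ∘ Equiv.swap v c) ∘ Equiv.swap w c) ∘ Equiv.swap v c := by
    rw [← Equiv.swap_mul_swap_mul_swap hwc.ne hvw.symm, Equiv.swap_comm c v]
    rfl
  have hv_right : Equiv.swap w c v = v := Equiv.swap_apply_of_ne_of_ne hvw hvc.ne
  have hw_left : Equiv.swap v c w = w := Equiv.swap_apply_of_ne_of_ne hvw.symm hwc.ne
  have step₁ : SwapStep G f (f ∘ Equiv.swap v c) := .of_uniqueIn_core hv hc hvc hv' hc'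
  have step₂ : SwapStep G (f ∘ Equiv.swap v c) ((f ∘ Equiv.swap v c) ∘ Equiv.swap w c) := by
    refine .of_uniqueIn_core hw hc hwc ?_ ?_ <;>
      simpa [uniqueIn_comp_swap, hv, hw, hc, hw_left]
  have step₃ : SwapStep G ((f ∘ Equiv.swap v c) ∘ Equiv.swap w c) (f ∘ Equiv.swap v w) := by
    rw [hconj]
    refine .of_uniqueIn_core hv hc hvc ?_ ?_ <;>
      simpa [uniqueIn_comp_swap, hv, hw, hc, hv_right, hw_left]
  exact .tail (.tail (.single step₁) step₂) step₃

theorem Movable.reflTransGen_swapStep (hG : P4Free G) (hv : Movable G f S v)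
    (hw : Movable G f S w) : Relation.ReflTransGen (SwapStep G) f (f ∘ Equiv.swap v w) := by
  obtain ⟨⟨x, y, hxy, rfl⟩, hvS, hv'⟩ := hv
  obtain ⟨-, hwS, hw'⟩ := hw
  by_cases hvw : v = w
  · rw [hvw, Equiv.swap_self]
    exact .refl
  by_cases hadj : G.Adj v w
  · exact .single (.of_uniqueIn_core hvS hwS hadj hv' hw')
  rcases exists_common_neighbor_of_not_adj hG hxy.1 hvS hwS hadj with ⟨hvx, hwx⟩ | ⟨hvy, hwy⟩
  · exact reflTransGen_swapStep_of_common_neighbor hvS hwS (left_mem_core hxy.1) hv' hw' hxy.2.1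
      hvw hvx hwx
  · exact reflTransGen_swapStep_of_common_neighbor hvS hwS (right_mem_core hxy.1) hv' hw' hxy.2.2
      hvw hvy hwy

theorem Compatible.of_reflTransGen (hG : P4Free G) (h : Relation.ReflTransGen (SwapStep G) f g)
    (hg : Compatible G g f') : Compatible G f f' := by
  induction h using Relation.ReflTransGen.head_induction_on with
  | refl => exact hg
  | head hstep _ ih =>
    obtain ⟨a, b, hab, rfl⟩ := hstep
    exact ih.of_comp_swap hG hab

theorem ncard_ne_comp_swap_lt [Finite V] (hv : f v ≠ f' v) (hw : f w ≠ f' w) (hwv : f' w = f v) :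
    {u | (f ∘ Equiv.swap v w) u ≠ f' u}.ncard < {u | f u ≠ f' u}.ncard := by
  refine Set.ncard_lt_ncard (Set.ssubset_iff_of_subset ?_ |>.2 ⟨w, hw, by simp [hwv]⟩)
  intro u hu
  by_cases huv : u = v
  · exact huv ▸ hv
  by_cases huw : u = w
  · exact huw ▸ hw
  simpa [Equiv.swap_apply_of_ne_of_ne huv huw] using hu

theorem reflTransGen_swapStep_iff_compatible (hG : P4Free G) [Finite V] :
    Relation.ReflTransGen (SwapStep G) f f' ↔ Compatible G f f' := by
  refine ⟨fun h => .of_reflTransGen hG h (.refl f'), fun h => ?_⟩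
  induction hm : {u | f u ≠ f' u}.ncard using Nat.strong_induction_on generalizing f with
  | _ m ih =>
    by_cases hne : f = f'
    · exact hne ▸ .refl
    obtain ⟨S, v, w, hv, hw, hvf, hwf, hwv⟩ := h.exists_exchange hG hne
    have hswap := hv.reflTransGen_swapStep hG hw
    exact hswap.trans (ih _ (hm ▸ ncard_ne_comp_swap_lt hvf hwf hwv)
      (.of_reflTransGen hG (symm hswap) h) rfl)

end SwapStep

section Reconfiguration

variable {V : Type*} [DecidableEq V] {G : SimpleGraph V} {k : ℕ} {a b : V}

theorem exists_coe_eq_comp_swap (hG : P4Free G) {f : G.Coloring (Fin k)} (hab : Active G f a b) :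
    ∃ f' : G.Coloring (Fin k), ⇑f' = f ∘ Equiv.swap a b := by
  have h := (active_iff_of_proper hG fun _ _ => f.valid).1 hab
  refine ⟨SimpleGraph.Coloring.mk (f ∘ Equiv.swap a b) fun {u v} huv => ?_, rfl⟩
  have := f.valid huv
  have := f.valid hab.1
  grind [G.adj_comm]

theorem swapAdj_iff_swapStep (hG : P4Free G) {f f' : G.Coloring (Fin k)} :
    SwapAdj G f f' ↔ SwapStep G f f' := by
  refine exists₂_congr fun a b => ?_
  rw [active_iff_of_proper hG fun _ _ => f.valid]
  constructor
  · rintro ⟨hab, ha, hb, -, heq⟩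
    refine ⟨⟨hab, fun u hub hua => ?_, fun u hua hub => ?_⟩, ?_⟩
    · by_contra hne
      exact f'.valid hub (by rw [← heq u hne hub.ne, hua, ha])
    · by_contra hne
      exact f'.valid hua (by rw [← heq u hua.ne hne, hub, hb])
    · ext w
      grind
  · rintro ⟨⟨hab, hunique⟩, heq⟩
    refine ⟨hab, by simp [heq], by simp [heq], fun x y hxy => ?_, fun w hwa hwb => ?_⟩
    · have := f.valid hxy
      simp only [heq, Function.comp_apply, Equiv.swap_apply_def, Sym2.eq_iff]
      grind
    · simp [heq, Equiv.swap_apply_of_ne_of_ne hwa hwb]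

theorem reconfigurable_iff_reflTransGen_swapStep (hG : P4Free G) {f f' : G.Coloring (Fin k)} :
    Reconfigurable G f f' ↔ Relation.ReflTransGen (SwapStep G) f f' := by
  refine ⟨fun h => h.lift DFunLike.coe fun _ _ => (swapAdj_iff_swapStep hG).1, fun h => ?_⟩
  generalize hf : ⇑f = f₀ at h
  induction h using Relation.ReflTransGen.head_induction_on generalizing f with
  | refl => exact DFunLike.coe_injective hf ▸ .refl
  | head hstep _ ih =>
    obtain ⟨a, b, hab, rfl⟩ := hf ▸ hstep
    obtain ⟨g, hg⟩ := exists_coe_eq_comp_swap hG hab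
    exact .head ((swapAdj_iff_swapStep hG).2 ⟨a, b, hab, hg⟩) (ih hg)

end Reconfiguration

theorem reconfigurable_iff_compatible {V : Type*} [Finite V] {G : SimpleGraph V} {k : ℕ}
    (hG : P4Free G) {f f' : G.Coloring (Fin k)} : Reconfigurable G f f' ↔ Compatible G f f' := by
  classical
  rw [reconfigurable_iff_reflTransGen_swapStep hG, reflTransGen_swapStep_iff_compatible hG]

end CRCS

/-! ### First-order model checking on the random access machine -/

namespace RAM

section HaltsWithin

/-- Total correctness with a time bound: the program `p`, started in `s`, halts after at most `T`
steps in a state that satisfies `Q`. -/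
def HaltsWithin (p : Prog) (s : State) (T : ℕ) (Q : State → Prop) : Prop :=
  ∃ t s', Exec p s t s' ∧ t ≤ T ∧ Q s'

variable {p q : Prog} {s : State} {T T' x a : ℕ} {e i : Expr} {Q R : State → Prop}

theorem HaltsWithin.mono (h : HaltsWithin p s T R) (hT : T ≤ T') (hRQ : ∀ s', R s' → Q s') :
    HaltsWithin p s T' Q := by
  obtain ⟨t, s', hp, ht, hR⟩ := h
  exact ⟨t, s', hp, ht.trans hT, hRQ s' hR⟩

theorem haltsWithin_assign (h : Q (s.setVar x (e.eval s))) :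
    HaltsWithin (.assign x e) s (e.cost + 1) Q :=
  ⟨_, _, .assign s x e, le_rfl, h⟩

theorem haltsWithin_store (h : Q (s.setArr a (i.eval s) (e.eval s))) :
    HaltsWithin (.store a i e) s (i.cost + e.cost + 1) Q :=
  ⟨_, _, .store s a i e, le_rfl, h⟩

theorem HaltsWithin.seq (hp : HaltsWithin p s T R) (hq : ∀ s', R s' → HaltsWithin q s' T' Q) :
    HaltsWithin (.seq p q) s (T + T') Q := by
  obtain ⟨t, s', hp, ht, hR⟩ := hp
  obtain ⟨t', s'', hq, ht', hQ⟩ := hq s' hR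
  exact ⟨t + t', s'', .seq hp hq, Nat.add_le_add ht ht', hQ⟩

theorem HaltsWithin.assign_seq (hp : HaltsWithin p (s.setVar x (e.eval s)) T Q) :
    HaltsWithin (.seq (.assign x e) p) s (e.cost + 1 + T) Q :=
  (haltsWithin_assign (Q := (· = _)) rfl).seq fun _ hs' => hs' ▸ hp

theorem haltsWithin_cond (hp : e.eval s ≠ 0 → HaltsWithin p s T Q)
    (hq : e.eval s = 0 → HaltsWithin q s T Q) :
    HaltsWithin (.cond e p q) s (e.cost + 1 + T) Q := by
  by_cases he : e.eval s = 0
  · obtain ⟨t, s', hq, ht, hQ⟩ := hq he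
    exact ⟨_, s', .cond_false he hq, by gcongr, hQ⟩
  · obtain ⟨t, s', hp, ht, hQ⟩ := hp he
    exact ⟨_, s', .cond_true he hp, by gcongr, hQ⟩

theorem haltsWithin_loop {Inv : State → Prop} {μ : State → ℕ}
    (hstep : ∀ s, Inv s → e.eval s ≠ 0 → HaltsWithin p s T fun s' => Inv s' ∧ μ s' < μ s)
    (hs : Inv s) :
    HaltsWithin (.loop e p) s (μ s * (e.cost + 1 + T) + (e.cost + 1))
      fun s' => Inv s' ∧ e.eval s' = 0 := by
  induction hm : μ s using Nat.strong_induction_on generalizing s with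
  | _ m ih =>
    by_cases he : e.eval s = 0
    · exact ⟨_, s, .loop_false he, Nat.le_add_left _ _, hs, he⟩
    obtain ⟨t, s', hp, ht, hs', hlt⟩ := hstep s hs he
    obtain ⟨t', s'', hloop, ht', hQ⟩ := ih (μ s') (hm ▸ hlt) hs' rfl
    refine ⟨_, s'', .loop_true he hp hloop, ?_, hQ⟩
    calc e.cost + 1 + t + t'
        ≤ e.cost + 1 + T + (μ s' * (e.cost + 1 + T) + (e.cost + 1)) := by gcongr
      _ = (μ s' + 1) * (e.cost + 1 + T) + (e.cost + 1) := by ring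
      _ ≤ m * (e.cost + 1 + T) + (e.cost + 1) := by gcongr; omega

end HaltsWithin

section ModelChecking

open FirstOrder FirstOrder.Language

variable {L : Language} {ρ : ∀ {l : ℕ}, L.Relations l → (Fin l → Expr) → Expr}
  {A : ℕ → ℕ → ℕ} {N n : ℕ} {p q : Prog} {b c : Polynomial ℕ} {s : State}

/-- The memory contents `A` present a structure with universe `{0, …, N - 1}`: the number `N` is the
entry 0 of the array 0, and the expression `ρ R es`, in which `es` are the arguments, is nonzero
exactly if the relation `R` holds. -/
structure Presents (ρ : ∀ {l : ℕ}, L.Relations l → (Fin l → Expr) → Expr) (A : ℕ → ℕ → ℕ)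
    (N : ℕ) [L.Structure (Fin N)] : Prop where
  card : A 0 0 = N
  eval_ne_zero_iff {l : ℕ} (R : L.Relations l) {es : Fin l → Expr} {xs : Fin l → Fin N}
    {s : State} (hs : s.arr = A) (hes : ∀ i, (es i).eval s = xs i) :
    (ρ R es).eval s ≠ 0 ↔ Structure.RelMap R xs

/-- The arrays contain `A`, and the variables `1, …, n` contain `xs`. The variable `0` is left for
truth values. -/
structure Stores (A : ℕ → ℕ → ℕ) (xs : Fin n → Fin N) (s : State) : Prop where
  arr : s.arr = A
  var (i : Fin n) : s.var (i + 1) = xs i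

theorem Stores.setVar_zero {xs : Fin n → Fin N} (h : Stores A xs s) (m : ℕ) :
    Stores A xs (s.setVar 0 m) :=
  ⟨h.arr, fun i => by simpa [State.setVar] using h.var i⟩

theorem Stores.setVar_succ {xs : Fin n → Fin N} (h : Stores A xs s) (m : ℕ) :
    Stores A xs (s.setVar (n + 1) m) :=
  ⟨h.arr, fun i => by simpa [State.setVar, i.2.ne] using h.var i⟩

theorem stores_snoc {xs : Fin n → Fin N} {x : Fin N} :
    Stores A (Fin.snoc xs x : Fin (n + 1) → Fin N) s ↔ Stores A xs s ∧ s.var (n + 1) = x := by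
  refine ⟨fun h => ⟨⟨h.arr, fun i => ?_⟩, ?_⟩, fun ⟨h, hx⟩ => ⟨h.arr, Fin.lastCases ?_ fun i => ?_⟩⟩
  · simpa using h.var i.castSucc
  · simpa using h.var (Fin.last n)
  · simpa using hx
  · simpa using h.var i

/-- In a relational language a term is a variable; its value is read off from the memory. -/
def termExpr [L.IsRelational] : L.Term (Empty ⊕ Fin n) → Expr
  | .var (.inl x) => x.elim
  | .var (.inr i) => .var (i + 1)
  | .func f _ => isEmptyElim f

theorem eval_termExpr [L.IsRelational] [L.Structure (Fin N)] {xs : Fin n → Fin N}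
    (h : Stores A xs s) (t : L.Term (Empty ⊕ Fin n)) :
    (termExpr t).eval s = t.realize (Sum.elim default xs) := by
  match t with
  | .var (.inl x) => exact x.elim
  | .var (.inr i) => exact h.var i
  | .func f _ => exact isEmptyElim f

/-- The variable 0 contains the truth value of `P`. -/
def Answers (s : State) (P : Prop) : Prop := (P → s.var 0 = 1) ∧ (¬ P → s.var 0 = 0)

theorem answers_setVar_zero_iff {P : Prop} {m : ℕ} :
    Answers (s.setVar 0 m) P ↔ (P → m = 1) ∧ (¬ P → m = 0) := by
  simp [Answers, State.setVar]

theorem Answers.ne_zero_iff {P : Prop} (h : Answers s P) : s.var 0 ≠ 0 ↔ P := by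
  by_cases hP : P
  · simp [hP, h.1 hP]
  · simp [hP, h.2 hP]

/-- On every memory presenting an `L`-structure of `N` elements, the program `p` stores the truth
value of `φ` in the variable 0 within `b(N)` steps, without changing the structure or the values of
the free variables. -/
def Decides (ρ : ∀ {l : ℕ}, L.Relations l → (Fin l → Expr) → Expr) (p : Prog) (b : Polynomial ℕ)
    (φ : L.BoundedFormula Empty n) : Prop :=
  ∀ ⦃A : ℕ → ℕ → ℕ⦄ ⦃N : ℕ⦄ [L.Structure (Fin N)] (xs : Fin n → Fin N) (s : State),
    Presents ρ A N → Stores A xs s →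
      HaltsWithin p s (b.eval N) fun s' => Stores A xs s' ∧ Answers s' (φ.Realize default xs)

theorem decides_assign {φ : L.BoundedFormula Empty n} {e : Expr}
    (h : ∀ ⦃A : ℕ → ℕ → ℕ⦄ ⦃N : ℕ⦄ [L.Structure (Fin N)] (xs : Fin n → Fin N) (s : State),
      Presents ρ A N → Stores A xs s →
        (φ.Realize default xs → e.eval s = 1) ∧ (¬ φ.Realize default xs → e.eval s = 0)) :
    Decides ρ (.assign 0 e) (.C (e.cost + 1)) φ := by
  intro A N _ xs s hA hs
  rw [Polynomial.eval_C]
  exact haltsWithin_assign ⟨hs.setVar_zero _, answers_setVar_zero_iff.2 (h xs s hA hs)⟩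

theorem decides_falsum :
    Decides ρ (.assign 0 (.const 0)) (.C 2) (BoundedFormula.falsum : L.BoundedFormula Empty n) :=
  decides_assign fun _ _ _ _ _ _ _ => by simp [Expr.eval, BoundedFormula.Realize]

theorem decides_equal [L.IsRelational] (t₁ t₂ : L.Term (Empty ⊕ Fin n)) :
    Decides ρ (.assign 0 (.eq (termExpr t₁) (termExpr t₂)))
      (.C ((Expr.eq (termExpr t₁) (termExpr t₂)).cost + 1)) (.equal t₁ t₂) :=
  decides_assign fun _ _ _ _ _ _ hs => by
    simp [Expr.eval, BoundedFormula.Realize, eval_termExpr hs, Fin.ext_iff]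

theorem decides_rel [L.IsRelational] {l : ℕ} (R : L.Relations l)
    (ts : Fin l → L.Term (Empty ⊕ Fin n)) :
    Decides ρ (.assign 0 (.lt (.const 0) (ρ R fun i => termExpr (ts i))))
      (.C ((Expr.lt (.const 0) (ρ R fun i => termExpr (ts i))).cost + 1)) (.rel R ts) :=
  decides_assign fun _ _ _ _ _ hA hs => by
    have hR := hA.eval_ne_zero_iff R hs.arr fun i => eval_termExpr hs (ts i)
    rw [BoundedFormula.Realize, ← hR]
    simp [Expr.eval, Nat.pos_iff_ne_zero]

theorem Decides.imp {φ ψ : L.BoundedFormula Empty n} (hφ : Decides ρ p b φ)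
    (hψ : Decides ρ q c ψ) :
    Decides ρ (.seq p (.cond (.var 0) q (.assign 0 (.const 1)))) (b + c + 4) (φ.imp ψ) := by
  intro A N _ xs s hA hs
  refine ((hφ xs s hA hs).seq (T' := 2 + (c.eval N + 2)) fun s' ⟨hs', hans⟩ =>
    haltsWithin_cond (fun hne => ?_) fun he => ?_).mono (by simp; omega) fun _ => id
  · refine (hψ xs s' hA hs').mono (Nat.le_add_right _ _) fun s'' hs'' => ?_
    rwa [BoundedFormula.realize_imp, imp_iff_right (hans.ne_zero_iff.1 hne)]
  · have htrue : Answers (s'.setVar 0 1) ((φ.imp ψ).Realize default xs) :=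
      answers_setVar_zero_iff.2
        ⟨fun _ => rfl, absurd fun hφ => absurd he (hans.ne_zero_iff.2 hφ)⟩
    exact (haltsWithin_assign ⟨hs'.setVar_zero 1, htrue⟩).mono (Nat.le_add_left _ _) fun _ => id

/-- The program that runs `p` for the values `0, …, N - 1` of the variable `x`, where `N` is the
entry 0 of the array 0, until `p` sets the variable 0 to 0. -/
def forAllProg (x : ℕ) (p : Prog) : Prog :=
  .seq (.assign 0 (.const 1)) <| .seq (.assign x (.const 0)) <|
    .loop (.sub (.lt (.var x) (.get 0 (.const 0))) (.sub (.const 1) (.var 0))) <|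
      .seq p (.assign x (.add (.var x) (.const 1)))

/-- The loop invariant of `forAllProg (n + 1) p`, if `p` decides `φ`: the variable 0 tells whether
`φ` holds for all elements that the loop has passed. -/
structure ForAllInv [L.Structure (Fin N)] (A : ℕ → ℕ → ℕ) (xs : Fin n → Fin N)
    (φ : L.BoundedFormula Empty (n + 1)) (s : State) : Prop where
  stores : Stores A xs s
  var_le : s.var (n + 1) ≤ N
  answers : Answers s (∀ y : Fin N, y < s.var (n + 1) → φ.Realize default (Fin.snoc xs y))

section ForAll

variable [L.Structure (Fin N)] {xs : Fin n → Fin N} {φ : L.BoundedFormula Empty (n + 1)}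

theorem ForAllInv.haltsWithin_step (h : ForAllInv A xs φ s) (hφ : Decides ρ p b φ)
    (hA : Presents ρ A N) (hlt : s.var (n + 1) < N) (hne : s.var 0 ≠ 0) :
    HaltsWithin (.seq p (.assign (n + 1) (.add (.var (n + 1)) (.const 1)))) s (b.eval N + 4)
      fun s' => ForAllInv A xs φ s' ∧ N - s'.var (n + 1) < N - s.var (n + 1) := by
  obtain ⟨x, hx⟩ : ∃ x : Fin N, s.var (n + 1) = x := ⟨⟨_, hlt⟩, rfl⟩
  have hbelow := h.answers.ne_zero_iff.1 hne
  rw [hx] at hbelow ⊢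
  refine (hφ (Fin.snoc xs x) s hA (stores_snoc.2 ⟨h.stores, hx⟩)).seq fun s' ⟨hs', hans⟩ =>
    haltsWithin_assign ?_
  obtain ⟨hs', hx'⟩ := stores_snoc.1 hs'
  simp only [Expr.eval, hx']
  have hvar : (s'.setVar (n + 1) (x + 1)).var (n + 1) = x + 1 := by simp [State.setVar]
  refine ⟨⟨hs'.setVar_succ _, hvar.trans_le x.2, ?_⟩, by rw [hvar]; omega⟩
  have hall : (∀ y : Fin N, (y : ℕ) < x + 1 → φ.Realize default (Fin.snoc xs y)) ↔
      φ.Realize default (Fin.snoc xs x) := by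
    refine ⟨fun h => h x (Nat.lt_succ_self _), fun h y hy => ?_⟩
    rcases Nat.lt_succ_iff_lt_or_eq.1 hy with hy | hy
    exacts [hbelow y hy, Fin.ext hy ▸ h]
  rw [hvar, hall]
  simpa [Answers, State.setVar] using hans

theorem ForAllInv.answers_all (h : ForAllInv A xs φ s) (hs : s.var 0 ≠ 0 → s.var (n + 1) = N) :
    Answers s (φ.all.Realize default xs) := by
  have hall : φ.all.Realize default xs ↔
      ∀ y : Fin N, y < s.var (n + 1) → φ.Realize default (Fin.snoc xs y) := by
    refine ⟨fun hall y _ => hall y, fun hbelow y => hbelow y ?_⟩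
    exact y.2.trans_eq (hs (h.answers.ne_zero_iff.2 hbelow)).symm
  rw [hall]
  exact h.answers

end ForAll

theorem Decides.all {φ : L.BoundedFormula Empty (n + 1)} (hφ : Decides ρ p b φ) :
    Decides ρ (forAllProg (n + 1) p) (.X * (b + 13) + 13) φ.all := by
  intro A N _ xs s hA hs
  have hstart : ForAllInv A xs φ ((s.setVar 0 1).setVar (n + 1) 0) :=
    ⟨(hs.setVar_zero _).setVar_succ _, by simp [State.setVar], by simp [Answers, State.setVar]⟩
  have hcond {s : State} (h : ForAllInv A xs φ s) :
      Expr.eval s (.sub (.lt (.var (n + 1)) (.get 0 (.const 0))) (.sub (.const 1) (.var 0))) ≠ 0 ↔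
        s.var (n + 1) < N ∧ s.var 0 ≠ 0 := by
    simp only [Expr.eval, h.stores.arr, hA.card]
    split_ifs <;> omega
  have hloop := haltsWithin_loop (μ := fun s => N - s.var (n + 1))
    (fun s (h : ForAllInv A xs φ s) hne =>
      h.haltsWithin_step hφ hA ((hcond h).1 hne).1 ((hcond h).1 hne).2) hstart
  refine hloop.assign_seq.assign_seq.mono ?_ fun s' ⟨hs', hzero⟩ => ⟨hs'.stores, ?_⟩
  · simp only [Polynomial.eval_add, Polynomial.eval_mul, Polynomial.eval_X, Polynomial.eval_ofNat,
      Expr.cost, State.setVar, Function.update_self, Nat.sub_zero]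
    exact le_of_eq (by ring)
  · refine hs'.answers_all fun hne => hs'.var_le.antisymm (not_lt.1 fun hlt => ?_)
    exact (hcond hs').2 ⟨hlt, hne⟩ hzero

theorem exists_decides [L.IsRelational] (φ : L.BoundedFormula Empty n) :
    ∃ p b, Decides ρ p b φ := by
  induction φ with
  | falsum => exact ⟨_, _, decides_falsum⟩
  | equal t₁ t₂ => exact ⟨_, _, decides_equal t₁ t₂⟩
  | rel R ts => exact ⟨_, _, decides_rel R ts⟩
  | imp φ ψ hφ hψ =>
    obtain ⟨p, b, hφ⟩ := hφ
    obtain ⟨q, c, hψ⟩ := hψ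
    exact ⟨_, _, hφ.imp hψ⟩
  | all φ hφ =>
    obtain ⟨p, b, hφ⟩ := hφ
    exact ⟨_, _, hφ.all⟩

end ModelChecking

/-- The program that stores `u * N` in the array 1 at every index `u ≤ N`, where `N` is the entry 0
of the array 0. -/
def multiplesProg : Prog :=
  .seq (.assign 1 (.const 0)) <| .seq (.assign 2 (.const 0)) <|
    .loop (.lt (.var 1) (.add (.get 0 (.const 0)) (.const 1))) <|
      .seq (.store 1 (.var 1) (.var 2)) <|
        .seq (.assign 2 (.add (.var 2) (.get 0 (.const 0)))) (.assign 1 (.add (.var 1) (.const 1)))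

/-- The loop invariant of `multiplesProg`, if the array 0 contains `input`: the products `u * N` are
stored for all `u` below the variable 1, and the variable 2 contains the next one. -/
structure MultiplesInv (input : ℕ → ℕ) (s : State) : Prop where
  arr_zero : s.arr 0 = input
  var_one_le : s.var 1 ≤ input 0 + 1
  var_two : s.var 2 = s.var 1 * input 0
  arr_one : ∀ u < s.var 1, s.arr 1 u = u * input 0

theorem MultiplesInv.haltsWithin_step {input : ℕ → ℕ} {s : State} (h : MultiplesInv input s)
    (hlt : s.var 1 < input 0 + 1) :
    HaltsWithin (.seq (.store 1 (.var 1) (.var 2)) <|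
        .seq (.assign 2 (.add (.var 2) (.get 0 (.const 0)))) (.assign 1 (.add (.var 1) (.const 1))))
      s 12 fun s' => MultiplesInv input s' ∧ input 0 + 1 - s'.var 1 < input 0 + 1 - s.var 1 := by
  refine (haltsWithin_store (Q := (· = _)) rfl).seq (T' := 9) fun _ hs' => hs' ▸
    (haltsWithin_assign ⟨⟨?_, ?_, ?_, fun u hu => ?_⟩, ?_⟩).assign_seq
  · simp [State.setVar, State.setArr, h.arr_zero]
  · simpa [State.setVar, State.setArr, Expr.eval] using Nat.le_of_lt_succ hlt
  · simp [State.setVar, State.setArr, Expr.eval, h.var_two, h.arr_zero, Nat.succ_mul]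
  · replace hu : u < s.var 1 + 1 := by simpa [State.setVar, State.setArr, Expr.eval] using hu
    rcases Nat.lt_succ_iff_lt_or_eq.1 hu with hu | rfl
    · simp [State.setVar, State.setArr, Expr.eval, hu.ne, h.arr_one u hu]
    · simp [State.setVar, State.setArr, Expr.eval, h.var_two]
  · simp [State.setVar, State.setArr, Expr.eval]
    omega

theorem haltsWithin_multiplesProg (s : State) :
    HaltsWithin multiplesProg s (19 * s.arr 0 0 + 30) fun s' =>
      s'.arr 0 = s.arr 0 ∧ ∀ u ≤ s.arr 0 0, s'.arr 1 u = u * s.arr 0 0 := by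
  have hstart : MultiplesInv (s.arr 0) ((s.setVar 1 0).setVar 2 0) :=
    ⟨rfl, by simp [State.setVar], by simp [State.setVar], by simp [State.setVar]⟩
  have hcond {s' : State} (h : MultiplesInv (s.arr 0) s') :
      Expr.eval s' (.lt (.var 1) (.add (.get 0 (.const 0)) (.const 1))) ≠ 0 ↔
        s'.var 1 < s.arr 0 0 + 1 := by
    simp [Expr.eval, h.arr_zero]
  have hloop := haltsWithin_loop (μ := fun s' => s.arr 0 0 + 1 - s'.var 1)
    (fun s' (h : MultiplesInv (s.arr 0) s') hne => h.haltsWithin_step ((hcond h).1 hne)) hstart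
  refine hloop.assign_seq.assign_seq.mono ?_ fun s' ⟨hs', hzero⟩ =>
    ⟨hs'.arr_zero, fun u hu => hs'.arr_one u ?_⟩
  · simp [Expr.cost, State.setVar]
    omega
  · have := not_lt.1 (mt (hcond hs').2 (not_not.2 hzero))
    omega

theorem monotone_polynomial_eval {R : Type*} [CommSemiring R] [PartialOrder R] [IsOrderedRing R]
    [CanonicallyOrderedAdd R] (b : Polynomial R) : Monotone fun x => b.eval x := fun x y h => by
  simp only [Polynomial.eval_eq_sum_range]
  gcongr

end RAM

/-! ### Instances as first-order structures -/

namespace CRCS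

section Formulas

open FirstOrder FirstOrder.Language

/-- The relation symbols of `instanceLanguage`. -/
inductive InstanceRel : ℕ → Type
  | adj : InstanceRel 2
  | sameSource : InstanceRel 2
  | targetSource : InstanceRel 2

/-- The first-order language of instances: adjacency, equality of the source colors of two vertices,
and equality of the target color of a vertex and the source color of another one. -/
def instanceLanguage : Language := ⟨fun _ => Empty, InstanceRel⟩

instance : instanceLanguage.IsRelational := fun _ => inferInstanceAs (IsEmpty Empty)

instance (I : Instance) : instanceLanguage.Structure (Fin I.n) where
  RelMap
    | .adj => fun xs => I.G.Adj (xs 0) (xs 1)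
    | .sameSource => fun xs => I.fs (xs 0) = I.fs (xs 1)
    | .targetSource => fun xs => I.ft (xs 0) = I.fs (xs 1)

variable {n : ℕ} (i j v w : Fin n)

/-- The atomic formula `R x_i x_j`. -/
def atom (R : InstanceRel 2) : instanceLanguage.BoundedFormula Empty n :=
  Relations.boundedFormula₂ (L := instanceLanguage) R (&i) (&j)

/-- The formula `x_w ∈ core x_i x_j`. -/
def coreFormula : instanceLanguage.BoundedFormula Empty n :=
  (atom w i .adj ⊔ atom w j .adj) ⊓
    ∀' (atom (Fin.last n) w.castSucc .adj ⟹
      atom (Fin.last n) i.castSucc .adj ⊔ atom (Fin.last n) j.castSucc .adj)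

/-- The formula that says that the source color of `x_v` is unique in `core x_i x_j`. -/
def uniqueFormula : instanceLanguage.BoundedFormula Empty n :=
  ∀' (coreFormula i.castSucc j.castSucc (Fin.last n) ⟹
    atom (Fin.last n) v.castSucc .sameSource ⟹ &(Fin.last n) =' &v.castSucc)

/-- The formula `Active x_i x_j`, for the source coloring. -/
def activeFormula : instanceLanguage.BoundedFormula Empty n :=
  atom i j .adj ⊓ uniqueFormula i j i ⊓ uniqueFormula i j j

/-- The formula `Reaches x_v x_w`, for the source coloring. -/
def reachesFormula : instanceLanguage.BoundedFormula Empty n :=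
  (&w =' &v) ⊔ ∃' ∃'
    let x := (Fin.last n).castSucc
    let y := Fin.last (n + 1)
    let v := v.castSucc.castSucc
    let w := w.castSucc.castSucc
    activeFormula x y ⊓ coreFormula x y v ⊓ uniqueFormula x y v ⊓ coreFormula x y w

/-- The sentence that says that the source and the target coloring are compatible. -/
def compatibleSentence : instanceLanguage.Sentence :=
  ∀' ∃' (reachesFormula 0 1 ⊓ atom 1 0 .targetSource)

variable {I : Instance} {xs : Fin n → Fin I.n} {i j v w}

theorem realize_atom_adj :
    (atom i j .adj).Realize default xs ↔ I.G.Adj (xs i) (xs j) :=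
  BoundedFormula.realize_rel₂

theorem realize_atom_sameSource :
    (atom i j .sameSource).Realize default xs ↔ I.fs (xs i) = I.fs (xs j) :=
  BoundedFormula.realize_rel₂

theorem realize_atom_targetSource :
    (atom i j .targetSource).Realize default xs ↔ I.ft (xs i) = I.fs (xs j) :=
  BoundedFormula.realize_rel₂

theorem realize_coreFormula :
    (coreFormula i j w).Realize default xs ↔ xs w ∈ core I.G (xs i) (xs j) := by
  simp [coreFormula, core, realize_atom_adj]

theorem realize_uniqueFormula :
    (uniqueFormula i j v).Realize default xs ↔
      UniqueIn I.fs (core I.G (xs i) (xs j)) (xs v) := by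
  simp [uniqueFormula, UniqueIn, realize_coreFormula, realize_atom_sameSource]

theorem realize_activeFormula :
    (activeFormula i j).Realize default xs ↔ Active I.G I.fs (xs i) (xs j) := by
  simp [activeFormula, Active, realize_uniqueFormula, realize_atom_adj, and_assoc]

theorem realize_reachesFormula :
    (reachesFormula v w).Realize default xs ↔ Reaches I.G I.fs (xs v) (xs w) := by
  simp [reachesFormula, Reaches, Movable, IsActiveCore, realize_uniqueFormula, realize_coreFormula,
    realize_activeFormula, and_assoc]

theorem realize_compatibleSentence :
    (Fin I.n) ⊨ compatibleSentence ↔ Compatible I.G I.fs I.ft := by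
  simp [compatibleSentence, Sentence.Realize, Formula.Realize, Compatible, realize_reachesFormula,
    realize_atom_targetSource, Fin.snoc]

end Formulas

end CRCS

namespace CRCS

section Encoding

open RAM

theorem Instance.getD_encode_zero (I : Instance) : I.encode.getD 0 0 = I.n := by
  simp [Instance.encode]

theorem Instance.getD_encode_adj (I : Instance) (u v : Fin I.n) :
    I.encode.getD (2 + (u * I.n + v)) 0 ≠ 0 ↔ I.G.Adj u v := by
  let uv := finProdFinEquiv (u, v)
  have huv : (uv.divNat, uv.modNat) = (u, v) := finProdFinEquiv.symm_apply_apply (u, v)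
  obtain ⟨hu, hv⟩ := Prod.mk.inj huv
  have hval : u * I.n + v = (uv : ℕ) := by simp [uv, mul_comm, add_comm]
  rw [hval]
  simp [Instance.encode, add_comm 2, List.getElem?_append, hu, hv]

theorem Instance.getD_encode_source (I : Instance) (v : Fin I.n) :
    I.encode.getD (2 + (I.n * I.n + v)) 0 = I.fs v := by
  simp [Instance.encode, add_comm 2, List.getElem?_append]

theorem Instance.getD_encode_target (I : Instance) (v : Fin I.n) :
    I.encode.getD (2 + (I.n * I.n + (I.n + v))) 0 = I.ft v := by
  simp [Instance.encode, add_comm 2]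

theorem Instance.n_le_inputSize (I : Instance) : I.n ≤ inputSize I.encode := by
  have hlength (l : List ℕ) : l.length ≤ inputSize l := by simp [inputSize, List.sum_map_add]
  refine le_trans ?_ (hlength _)
  simp [Instance.encode]
  omega

/-- The expression that reads off the source color of the vertex `e`. -/
def sourceExpr (e : Expr) : Expr :=
  .get 0 (.add (.const 2) (.add (.get 1 (.get 0 (.const 0))) e))

/-- The expression that reads off the target color of the vertex `e`. -/
def targetExpr (e : Expr) : Expr :=
  .get 0 (.add (.const 2) (.add (.get 1 (.get 0 (.const 0))) (.add (.get 0 (.const 0)) e)))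

/-- The expression that evaluates a relation symbol, once `multiplesProg` has prepared the offsets
of the rows of the adjacency matrix. -/
def relExpr : ∀ {l : ℕ}, instanceLanguage.Relations l → (Fin l → Expr) → Expr
  | _, .adj, es => .get 0 (.add (.const 2) (.add (.get 1 (es 0)) (es 1)))
  | _, .sameSource, es => .eq (sourceExpr (es 0)) (sourceExpr (es 1))
  | _, .targetSource, es => .eq (targetExpr (es 0)) (sourceExpr (es 1))

theorem presents_relExpr {I : Instance} {A : ℕ → ℕ → ℕ} (hinput : ∀ i, A 0 i = I.encode.getD i 0)
    (hmul : ∀ u ≤ I.n, A 1 u = u * I.n) : Presents relExpr A I.n where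
  card := (hinput 0).trans I.getD_encode_zero
  eval_ne_zero_iff {l} R es xs s hs hes := by
    subst hs
    have hn : s.arr 0 0 = I.n := (hinput 0).trans I.getD_encode_zero
    have hsource {e : Expr} {v : Fin I.n} (he : e.eval s = v) :
        (sourceExpr e).eval s = I.fs v := by
      rw [← I.getD_encode_source, ← hinput]
      simp only [sourceExpr, Expr.eval, hn, hmul _ le_rfl, he]
    have htarget {e : Expr} {v : Fin I.n} (he : e.eval s = v) :
        (targetExpr e).eval s = I.ft v := by
      rw [← I.getD_encode_target, ← hinput]
      simp only [targetExpr, Expr.eval, hn, hmul _ le_rfl, he]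
    cases R with
    | adj =>
      refine Iff.trans ?_ (I.getD_encode_adj (xs 0) (xs 1))
      simp only [relExpr, Expr.eval, hes, hmul _ (xs 0).2.le, hinput]
    | sameSource =>
      refine Iff.trans ?_ (Fin.ext_iff (a := I.fs (xs 0)) (b := I.fs (xs 1))).symm
      simp [relExpr, Expr.eval, hsource (hes _)]
    | targetSource =>
      refine Iff.trans ?_ (Fin.ext_iff (a := I.ft (xs 0)) (b := I.fs (xs 1))).symm
      simp [relExpr, Expr.eval, hsource (hes _), htarget (hes _)]

end Encoding

end CRCS

theorem mainTheorem5 :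
    RAM.SolvableInPolyTime CRCS.Instance.encode
      (fun I : CRCS.Instance => CRCS.IsCograph I.G) CRCS.Instance.IsYes := by
  obtain ⟨p, b, hp⟩ := RAM.exists_decides (ρ := CRCS.relExpr) CRCS.compatibleSentence
  refine ⟨.seq RAM.multiplesProg p, 19 * .X + 30 + b, fun I hI => ?_⟩
  have hmul := RAM.haltsWithin_multiplesProg (RAM.State.init I.encode)
  rw [show (RAM.State.init I.encode).arr 0 0 = I.n from I.getD_encode_zero] at hmul
  obtain ⟨t, s, hexec, ht, hans⟩ := hmul.seq fun s ⟨hinput, hmul⟩ =>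
    (hp (A := s.arr) default s (CRCS.presents_relExpr (congrFun hinput) hmul)
      ⟨rfl, fun i => i.elim0⟩).mono le_rfl fun _ => And.right
  have hyes : I.IsYes ↔ CRCS.compatibleSentence.Realize (Fin I.n) :=
    (CRCS.reconfigurable_iff_compatible hI.p4Free).trans CRCS.realize_compatibleSentence.symm
  have ht : t ≤ (19 * .X + 30 + b : Polynomial ℕ).eval I.n := by simpa using ht
  exact ⟨t, s, hexec, ht.trans (RAM.monotone_polynomial_eval _ I.n_le_inputSize),
    fun h => hans.1 (hyes.1 h), fun h => hans.2 (mt hyes.2 h)⟩
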